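/- Let $W\subset\mathbb{R}^2$ (the local workspace), $P_{bg}^1,\dots,P_{bg}^k$ (the background obstacles) and $P_{mov}^1,\dots,P_{mov}^m$ (the movable obstacles) be polygons, that is, compact sets which are the closure of their interior and whose boundary is contained in a finite union of line segments; the obstacles may intersect each other and the boundary of $W$. Let $C$ (a component $\mathcal{C}^i_{local}$) be a path component of the free space $\operatorname{int}(W)\setminus\big(\bigcup_i P_{bg}^i\cup\bigcup_j P_{mov}^j\big)$, and let $p$ be any point of $C$, for instance the topological waypoint $\mathbf{p}^i_{topo}\in\mathcal{C}^i_{local}$ chosen to represent it. Then $p$ sees at least three distinct vertices of $C$. Here a vertex of $C$ is a point $v\in\partial C$ such that $\partial C$ does not coincide, in any disc centred at $v$, with a straight line through $v$, and $p$ sees $v$ if every point strictly between $p$ and $v$ lies in $C$. -/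

import Mathlib

/-- The Euclidean plane, in which the polygons are extracted. -/
abbrev Plane : Type := EuclideanSpace ℝ (Fin 2)

/-- A (filled) polygon in the plane, possibly with holes: a compact set that is the closure of its
interior and whose boundary is contained in a union of finitely many straight line segments. -/
structure IsPolygonalRegion (K : Set Plane) : Prop where
  isCompact : IsCompact K
  closure_interior : closure (interior K) = K
  frontier_subset : ∃ s : Finset (Plane × Plane), frontier K ⊆ ⋃ e ∈ s, segment ℝ e.1 e.2

/-- The free space of a local workspace `W`: the points inside `W` that belong neither to one of the
background polygons `bg i` nor to one of the polygons `mov j` of the movable objects. -/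
def freeSpace {ι κ : Type*} (W : Set Plane) (bg : ι → Set Plane) (mov : κ → Set Plane) :
    Set Plane :=
  interior W \ ((⋃ i, bg i) ∪ ⋃ j, mov j)

/-- `C` is one of the path components into which the set `F` decomposes. -/
def IsPathComponentOf (C F : Set Plane) : Prop :=
  ∃ x ∈ F, C = pathComponentIn F x

/-- `v` is a vertex of the planar polygonal region `C`: a boundary point of `C` near which the
boundary of `C` is not a straight line through `v`. -/
def IsVertexOf (v : Plane) (C : Set Plane) : Prop :=
  v ∈ frontier C ∧
    ¬ ∃ r > (0 : ℝ), ∃ d : Plane, d ≠ 0 ∧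
      frontier C ∩ Metric.ball v r = Set.range (fun t : ℝ => v + t • d) ∩ Metric.ball v r

open Filter Topology

/-! Only openness and boundedness of `C` matter. The key claim: every open half-plane whose edge
passes through `p` contains a vertex seen from `p`. Its rays have directions `n + s • e`, `s` real;
let `r s` be the first exit parameter. Near an exit point that is not a vertex the boundary is a
line, and `1 / r` is affine along a line. If no exit point were a vertex, `1 / r` would be affine on
all of `ℝ`; being positive it would be constant, and the exit points would fill a whole line,
against boundedness. Given two points, some such half-plane avoids both, so two vertices never
suffice. -/

/-- The ray from `p` in direction `w` leaves the set `C` for the first time at parameter `r`. -/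
structure IsFirstExit (C : Set Plane) (p w : Plane) (r : ℝ) : Prop where
  pos : 0 < r
  notMem : p + r • w ∉ C
  mem : ∀ t, 0 ≤ t → t < r → p + t • w ∈ C

/-- A line through the origin of the plane is the kernel of a linear functional. -/
theorem exists_functional_eq_zero_iff (d : Plane) (hd : d ≠ 0) :
    ∃ φ : Plane →L[ℝ] ℝ, ∀ x, φ x = 0 ↔ ∃ t : ℝ, t • d = x := by
  refine ⟨d 0 • EuclideanSpace.proj 1 - d 1 • EuclideanSpace.proj 0, fun x => ?_⟩
  change d 0 * x 1 - d 1 * x 0 = 0 ↔ _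
  constructor
  · intro h
    by_cases h0 : d 0 = 0
    · have h1 : d 1 ≠ 0 := fun h1 => hd (by ext i; fin_cases i <;> simpa)
      refine ⟨x 1 / d 1, ?_⟩
      ext i
      fin_cases i
      · have : x 0 = 0 := by simpa [h0, h1] using h
        simp [h0, this]
      · simp [h1]
    · refine ⟨x 0 / d 0, ?_⟩
      ext i
      fin_cases i
      · simp [h0]
      · simp only [Fin.mk_one, PiLp.smul_apply, smul_eq_mul]
        field_simp
        linarith
  · rintro ⟨t, rfl⟩
    simp only [PiLp.smul_apply, smul_eq_mul]
    ring

theorem exists_isFirstExit {C : Set Plane} (hC : IsOpen C) (hb : Bornology.IsBounded C)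
    {p w : Plane} (hp : p ∈ C) (hw : w ≠ 0) : ∃ r, IsFirstExit C p w r := by
  set T : Set ℝ := {t | 0 ≤ t ∧ p + t • w ∉ C} with hT
  have hclosed : IsClosed T :=
    isClosed_Ici.inter (hC.isClosed_compl.preimage (f := fun t : ℝ => p + t • w) (by fun_prop))
  have hbdd : BddBelow T := ⟨0, fun t ht => ht.1⟩
  have hne : T.Nonempty := by
    obtain ⟨R, hR⟩ := hb.exists_norm_le
    have hw' : 0 < ‖w‖ := norm_pos_iff.2 hw
    have hR0 : 0 ≤ R := (norm_nonneg p).trans (hR p hp)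
    -- This parameter moves `p` by `2 * R + 1`, while points of `C` are at most `2 * R` apart.
    refine ⟨(2 * R + 1) / ‖w‖, by positivity, fun hmem => ?_⟩
    have h1 := hR _ hmem
    have h2 := hR p hp
    have h3 : ‖((2 * R + 1) / ‖w‖) • w‖ = 2 * R + 1 := by
      rw [norm_smul, Real.norm_of_nonneg (by positivity)]
      field_simp
    have h4 := norm_le_add_norm_add ((( 2 * R + 1) / ‖w‖) • w) p
    rw [add_comm _ p] at h4
    linarith
  have hmem : sInf T ∈ T := hclosed.csInf_mem hne hbdd
  refine ⟨sInf T, lt_of_le_of_ne hmem.1 fun h => hmem.2 ?_, hmem.2, fun t ht htr => ?_⟩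
  · rw [← h]
    simpa using hp
  · by_contra hn
    exact absurd (csInf_le hbdd ⟨ht, hn⟩) (not_le.2 htr)

namespace IsFirstExit

variable {C : Set Plane} {p w : Plane} {r : ℝ}

theorem le_of_notMem (h : IsFirstExit C p w r) {t : ℝ} (ht : 0 ≤ t) (hn : p + t • w ∉ C) :
    r ≤ t :=
  not_lt.1 fun hlt => hn (h.mem t ht hlt)

theorem mem_frontier (h : IsFirstExit C p w r) (hC : IsOpen C) : p + r • w ∈ frontier C := by
  rw [hC.frontier_eq]
  refine ⟨?_, h.notMem⟩
  have hcont : ContinuousWithinAt (fun t : ℝ => p + t • w) (Set.Ico 0 r) r := by fun_prop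
  refine hcont.mem_closure ?_ fun t ht => h.mem t ht.1 ht.2
  rw [closure_Ico h.pos.ne]
  exact ⟨h.pos.le, le_rfl⟩

theorem isVisible (h : IsFirstExit C p w r) : IsVisible ℝ Cᶜ p (p + r • w) := by
  rintro z hz ⟨⟨t, ht, rfl⟩, hz1, hz2⟩
  refine hz ?_
  have ht1 : t ≠ 1 := by
    rintro rfl
    exact hz2 (by simp)
  have : AffineMap.lineMap p (p + r • w) t = p + (t * r) • w := by
    simp [AffineMap.lineMap_apply, smul_smul, add_comm]
  rw [this]
  exact h.mem _ (mul_nonneg ht.1 h.pos.le)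
    (mul_lt_of_lt_one_left h.pos (lt_of_le_of_ne ht.2 ht1))

end IsFirstExit

/-- Where the first exit point is not a vertex, the reciprocal of the first exit parameter along
a pencil of rays is locally an affine function. -/
theorem eventually_inv_eq_affine_of_not_isVertexOf {C : Set Plane} (hC : IsOpen C)
    {p n e : Plane} {r : ℝ → ℝ} (hr : ∀ s, IsFirstExit C p (n + s • e) (r s)) (s₀ : ℝ)
    (hv : ¬ IsVertexOf (p + r s₀ • (n + s₀ • e)) C) :
    ∃ α β : ℝ, ∀ᶠ s in 𝓝 s₀, (r s)⁻¹ = α + β * s := by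
  have hfr := (hr s₀).mem_frontier hC
  have hr0 := (hr s₀).pos
  simp only [IsVertexOf, not_and, not_not] at hv
  obtain ⟨ρ, hρ, d, hd, hline⟩ := hv hfr
  set w : ℝ → Plane := fun s => n + s • e with hw
  set q : Plane := p + r s₀ • w s₀ with hq
  change frontier C ∩ Metric.ball q ρ = Set.range (fun t : ℝ => q + t • d) ∩ Metric.ball q ρ
    at hline
  obtain ⟨φ, hφ⟩ := exists_functional_eq_zero_iff d hd
  have hfrontier : ∀ x ∈ Metric.ball q ρ, x ∈ frontier C ↔ φ (x - q) = 0 := by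
    intro x hx
    have h1 : x ∈ frontier C ↔ x ∈ Set.range (fun t : ℝ => q + t • d) := by
      have := Set.ext_iff.1 hline x
      simpa only [Set.mem_inter_iff, hx, and_true] using this
    rw [h1, hφ, Set.mem_range]
    simp only [eq_sub_iff_add_eq, add_comm]
  have hball : Metric.ball q ρ ∈ 𝓝 q := Metric.ball_mem_nhds q hρ
  -- A ray along the boundary line would meet the frontier before its exit, inside the open set `C`.
  have hφw : φ (w s₀) ≠ 0 := by
    intro h0
    have hev : ∀ᶠ t in 𝓝[<] r s₀, p + t • w s₀ ∈ Metric.ball q ρ := by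
      have hc : ContinuousAt (fun t : ℝ => p + t • w s₀) (r s₀) := by fun_prop
      exact (hc.eventually hball).filter_mono nhdsWithin_le_nhds
    have hpos : ∀ᶠ t in 𝓝[<] r s₀, t ∈ Set.Ioo 0 (r s₀) := Ioo_mem_nhdsLT hr0
    obtain ⟨t, ht, ht'⟩ := (hev.and hpos).exists
    have hmem := (hr s₀).mem t ht'.1.le ht'.2
    have hf : p + t • w s₀ ∈ frontier C := by
      rw [hfrontier _ ht]
      simp [hq, h0]
    rw [hC.frontier_eq] at hf
    exact hf.2 hmem
  set k : ℝ := r s₀ * φ (w s₀) with hk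
  have hk0 : k ≠ 0 := mul_ne_zero hr0.ne' hφw
  -- When `l s` is nonzero, ray `s` crosses the boundary line at parameter `(l s)⁻¹`.
  set l : ℝ → ℝ := fun s => φ (w s) / k with hl
  have hlc : Continuous l := by simp only [hl, hw]; fun_prop
  have hls : l s₀ = (r s₀)⁻¹ := by
    simp only [hl, hk]
    field_simp
  have hiff : ∀ s t, p + t • w s ∈ Metric.ball q ρ → (p + t • w s ∈ frontier C ↔ t * l s = 1) := by
    intro s t hst
    rw [hfrontier _ hst]
    have : φ (p + t • w s - q) = t * φ (w s) - k := by
      simp only [hq, hk, map_sub, map_add, map_smul, smul_eq_mul]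
      ring
    rw [this, sub_eq_zero, hl]
    field_simp
  have hlinv : ContinuousAt (fun s => (l s)⁻¹) s₀ :=
    hlc.continuousAt.inv₀ (by rw [hls]; exact inv_ne_zero hr0.ne')
  have hlpos : ∀ᶠ s in 𝓝 s₀, 0 < l s :=
    hlc.continuousAt.eventually (lt_mem_nhds (by rw [hls]; positivity))
  have hub : ∀ᶠ s in 𝓝 s₀, r s ≤ (l s)⁻¹ := by
    have hx : ContinuousAt (fun s => p + (l s)⁻¹ • w s) s₀ := by
      have : ContinuousAt w s₀ := by simp only [hw]; fun_prop
      fun_prop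
    have hxball : ∀ᶠ s in 𝓝 s₀, p + (l s)⁻¹ • w s ∈ Metric.ball q ρ := by
      refine hx.eventually (p := (· ∈ Metric.ball q ρ)) ?_
      beta_reduce
      rw [hls, inv_inv]
      exact hball
    filter_upwards [hxball, hlpos] with s hs hs'
    refine (hr s).le_of_notMem (inv_nonneg.2 hs'.le) fun hmem => ?_
    have := (hiff s _ hs).2 (inv_mul_cancel₀ hs'.ne')
    rw [hC.frontier_eq] at this
    exact this.2 hmem
  -- Nearby rays cannot exit much earlier, elsewhere on the boundary: a compact initial segment
  -- stays in `C` under small changes of `s`.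
  have hlb : ∀ a < r s₀, ∀ᶠ s in 𝓝 s₀, a < r s := by
    intro a ha
    have : ∀ᶠ s in 𝓝 s₀, ∀ t ∈ Set.Icc 0 a, p + t • w s ∈ C := by
      refine isCompact_Icc.eventually_forall_of_forall_eventually fun t ht => ?_
      have hc : ContinuousAt (fun z : ℝ × ℝ => p + z.2 • w z.1) (s₀, t) := by
        simp only [hw]; fun_prop
      exact hc.eventually (hC.mem_nhds ((hr s₀).mem t ht.1 (ht.2.trans_lt ha)))
    filter_upwards [this] with s hs
    by_contra hn
    exact (hr s).notMem (hs _ ⟨(hr s).pos.le, not_lt.1 hn⟩)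
  have hrc : ContinuousAt r s₀ := by
    refine tendsto_order.2 ⟨hlb, fun b hb => ?_⟩
    have : ∀ᶠ s in 𝓝 s₀, (l s)⁻¹ < b :=
      hlinv.eventually (gt_mem_nhds (by beta_reduce; rw [hls, inv_inv]; exact hb))
    filter_upwards [this, hub] with s h1 h2 using h2.trans_lt h1
  have hqc : ContinuousAt (fun s => p + r s • w s) s₀ := by
    have : ContinuousAt w s₀ := by simp only [hw]; fun_prop
    fun_prop
  refine ⟨φ n / k, φ e / k, ?_⟩
  filter_upwards [hqc.eventually hball] with s hs
  have h1 := (hiff s _ hs).1 ((hr s).mem_frontier hC)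
  rw [inv_eq_of_mul_eq_one_right h1]
  simp only [hl, hw, map_add, map_smul, smul_eq_mul]
  ring

/-- The derivative is locally constant, hence constant because `ℝ` is connected. -/
theorem eq_affine_of_eventually_eq_affine {f : ℝ → ℝ}
    (hf : ∀ s₀, ∃ α β : ℝ, ∀ᶠ s in 𝓝 s₀, f s = α + β * s) :
    ∃ α β : ℝ, ∀ s, f s = α + β * s := by
  choose α β h using hf
  have hder : ∀ s₀, ∀ᶠ s in 𝓝 s₀, HasDerivAt f (β s₀) s := by
    intro s₀
    filter_upwards [(h s₀).eventually_nhds] with s hs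
    have : HasDerivAt (fun x => α s₀ + β s₀ * x) (β s₀) s := by
      simpa using ((hasDerivAt_id s).const_mul (β s₀)).const_add (α s₀)
    exact this.congr_of_eventuallyEq hs
  have hconst : IsLocallyConstant (deriv f) := by
    rw [IsLocallyConstant.iff_eventually_eq]
    intro s₀
    filter_upwards [hder s₀] with s hs
    rw [hs.deriv, (hder s₀).self_of_nhds.deriv]
  have hd : ∀ s, HasDerivAt f (deriv f 0) s := fun s => by
    rw [hconst.apply_eq_of_preconnectedSpace 0 s]
    exact (hder s).self_of_nhds.differentiableAt.hasDerivAt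
  refine ⟨f 0, deriv f 0, fun s => ?_⟩
  have hz : ∀ x, HasDerivAt (fun x => f x - deriv f 0 * x) 0 x := fun x => by
    simpa using! (hd x).sub ((hasDerivAt_id x).const_mul (deriv f 0))
  have := is_const_of_deriv_eq_zero (fun x => (hz x).differentiableAt) (fun x => (hz x).deriv) s 0
  simp only [mul_zero, sub_zero] at this
  linarith

/-- In a bounded open set, some ray of every pencil of rays filling an open half-plane ends
in a vertex. -/
theorem exists_isFirstExit_isVertexOf {C : Set Plane} (hC : IsOpen C)
    (hb : Bornology.IsBounded C) {p n e : Plane} (hp : p ∈ C) (he : e ≠ 0)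
    (hw : ∀ s : ℝ, n + s • e ≠ 0) :
    ∃ s r : ℝ, IsFirstExit C p (n + s • e) r ∧ IsVertexOf (p + r • (n + s • e)) C := by
  choose r hr using fun s => exists_isFirstExit hC hb hp (hw s)
  by_contra! hcon
  obtain ⟨α, β, hαβ⟩ := eq_affine_of_eventually_eq_affine fun s₀ =>
    eventually_inv_eq_affine_of_not_isVertexOf hC hr s₀ (hcon s₀ _ (hr s₀))
  have hpos : ∀ s, 0 < α + β * s := fun s => by
    rw [← hαβ]
    exact inv_pos.2 (hr s).pos
  have hβ : β = 0 := by
    by_contra hβ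
    -- A nonconstant affine function has a zero.
    have := hpos (-α / β)
    rw [mul_div_cancel₀ _ hβ] at this
    linarith
  have hrc : ∀ s, r s = α⁻¹ := fun s => by
    rw [← inv_inv (r s), hαβ, hβ, zero_mul, add_zero]
  obtain ⟨R, hR⟩ := hb.closure.exists_norm_le
  have hα : 0 < α := by simpa [hβ] using hpos 0
  have he' : 0 < ‖e‖ := norm_pos_iff.2 he
  have hbound : ∀ s : ℝ, α⁻¹ * (s * ‖e‖) ≤ R + ‖p + α⁻¹ • n‖ := by
    intro s
    have h1 := hR _ (frontier_subset_closure ((hr s).mem_frontier hC))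
    rw [hrc s] at h1
    have h2 : (α⁻¹ * s) • e = (p + α⁻¹ • (n + s • e)) - (p + α⁻¹ • n) := by
      rw [smul_add, smul_smul]
      abel
    have h3 := norm_sub_le (p + α⁻¹ • (n + s • e)) (p + α⁻¹ • n)
    rw [← h2, norm_smul] at h3
    have h4 : α⁻¹ * s * ‖e‖ ≤ ‖α⁻¹ * s‖ * ‖e‖ :=
      mul_le_mul_of_nonneg_right (Real.le_norm_self _) he'.le
    linarith
  -- This `s` makes the left side exceed the bound by exactly 1.
  have := hbound ((R + ‖p + α⁻¹ • n‖ + 1) * α / ‖e‖)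
  have h5 : α⁻¹ * ((R + ‖p + α⁻¹ • n‖ + 1) * α / ‖e‖ * ‖e‖) = R + ‖p + α⁻¹ • n‖ + 1 := by
    field_simp
  linarith

/-- Two prescribed points cannot contain all vertices visible from `p`. -/
theorem exists_isVertexOf_isVisible_ne {C : Set Plane} (hC : IsOpen C)
    (hb : Bornology.IsBounded C) {p : Plane} (hp : p ∈ C) (v₁ v₂ : Plane) :
    ∃ v, (IsVertexOf v C ∧ IsVisible ℝ Cᶜ p v) ∧ v ≠ v₁ ∧ v ≠ v₂ := by
  obtain ⟨e, he, c, hc⟩ : ∃ e : Plane, e ≠ 0 ∧ ∃ c : ℝ, c • e = v₁ - p := by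
    by_cases h : v₁ - p = 0
    · obtain ⟨e, he⟩ := exists_ne (0 : Plane)
      exact ⟨e, he, 0, by simp [h]⟩
    · exact ⟨v₁ - p, h, 1, one_smul _ _⟩
  obtain ⟨φ, hφe, ⟨n, hn⟩, h₂⟩ : ∃ φ : Plane →L[ℝ] ℝ, φ e = 0 ∧ (∃ n, 0 < φ n) ∧
      φ (v₂ - p) ≤ 0 := by
    obtain ⟨φ, hφ⟩ := exists_functional_eq_zero_iff e he
    have hφe : φ e = 0 := (hφ e).2 ⟨1, one_smul _ _⟩
    obtain ⟨x, hx⟩ : ∃ x, φ x ≠ 0 := by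
      by_contra! hall
      have hspan : ∀ x : Plane, ∃ t : ℝ, t • e = x := fun x => (hφ x).1 (hall x)
      have := finrank_le_one e hspan
      simp at this
    have hpos : ∃ n, 0 < φ n := by
      rcases lt_or_gt_of_ne hx with h | h
      · exact ⟨-x, by simpa using h⟩
      · exact ⟨x, h⟩
    -- The edge runs through `p` and `v₁`; the sign of `φ` is chosen to keep `v₂` out of the open
    -- side.
    rcases le_total (φ (v₂ - p)) 0 with h | h
    · exact ⟨φ, hφe, hpos, h⟩
    · obtain ⟨n, hn⟩ := hpos
      exact ⟨-φ, by simp [hφe], ⟨-n, by simpa using hn⟩, by simpa using h⟩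
  have hφw : ∀ s : ℝ, φ (n + s • e) = φ n := fun s => by simp [hφe]
  obtain ⟨s, r, hr, hv⟩ := exists_isFirstExit_isVertexOf (n := n) hC hb hp he fun s h => by
    have := hφw s
    rw [h, map_zero] at this
    exact hn.ne this
  have hpos : 0 < φ (p + r • (n + s • e) - p) := by
    rw [add_sub_cancel_left, map_smul, hφw]
    exact mul_pos hr.pos hn
  refine ⟨_, ⟨hv, hr.isVisible⟩, fun h => ?_, fun h => ?_⟩
  · rw [h, ← hc, map_smul, hφe, smul_zero] at hpos
    exact lt_irrefl _ hpos
  · rw [h] at hpos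
    exact absurd h₂ (not_le.2 hpos)

theorem three_le_encard_of_forall_exists_ne {α : Type*} {S : Set α}
    (h : ∀ a b, ∃ c ∈ S, c ≠ a ∧ c ≠ b) (hne : Nonempty α) : 3 ≤ S.encard := by
  obtain ⟨x₀⟩ := hne
  obtain ⟨a, ha, -⟩ := h x₀ x₀
  obtain ⟨b, hb, hba, -⟩ := h a a
  obtain ⟨c, hc, hca, hcb⟩ := h a b
  have hcard : ({a, b, c} : Set α).encard = 3 :=
    Set.encard_eq_three.2 ⟨a, b, c, hba.symm, hca.symm, hcb.symm, rfl⟩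
  rw [← hcard]
  refine Set.encard_le_encard ?_
  rintro x (rfl | rfl | rfl) <;> assumption

theorem isOpen_freeSpace {ι κ : Type*} [Finite ι] [Finite κ] {W : Set Plane}
    {bg : ι → Set Plane} {mov : κ → Set Plane} (hbg : ∀ i, IsClosed (bg i))
    (hmov : ∀ j, IsClosed (mov j)) : IsOpen (freeSpace W bg mov) :=
  isOpen_interior.sdiff ((isClosed_iUnion_of_finite hbg).union (isClosed_iUnion_of_finite hmov))

/-- Every point `p` of a component `C` of the free space (in particular the topological waypoint
that represents `C`) sees at least three vertices of `C`, where `p` sees `v` if all points strictly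
between `p` and `v` lie in `C`. -/
theorem theorem1 {ι κ : Type*} [Finite ι] [Finite κ]
    (W : Set Plane) (bg : ι → Set Plane) (mov : κ → Set Plane)
    (hW : IsPolygonalRegion W)
    (hbg : ∀ i, IsPolygonalRegion (bg i))
    (hmov : ∀ j, IsPolygonalRegion (mov j))
    (C : Set Plane) (hC : IsPathComponentOf C (freeSpace W bg mov))
    (p : Plane) (hp : p ∈ C) :
    3 ≤ {v : Plane | IsVertexOf v C ∧ IsVisible ℝ Cᶜ p v}.encard := by
  obtain ⟨x, -, rfl⟩ := hC
  have hopen : IsOpen (pathComponentIn (freeSpace W bg mov) x) :=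
    (isOpen_freeSpace (fun i => (hbg i).isCompact.isClosed)
      fun j => (hmov j).isCompact.isClosed).pathComponentIn x
  have hbdd : Bornology.IsBounded (pathComponentIn (freeSpace W bg mov) x) :=
    hW.isCompact.isBounded.subset
      (pathComponentIn_subset.trans (Set.sdiff_subset.trans interior_subset))
  exact three_le_encard_of_forall_exists_ne
    (exists_isVertexOf_isVisible_ne hopen hbdd hp) ⟨p⟩
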